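/- For a lattice $\Lambda\subset\mathbb R^2$ (a discrete subgroup spanning $\mathbb R^2$) let $\operatorname{dens}\Lambda$ denote the number of points of $\Lambda$ per unit area, i.e. the reciprocal of the area of a fundamental domain. For $\varepsilon>0$ let $E=\Lambda+B_\varepsilon(0)$, where $B_\varepsilon(0)$ is the open disk of radius $\varepsilon$ about the origin. For $\Theta\subseteq S^1$ let $R_\Theta E=\{R_\theta x:\theta\in\Theta,\ x\in E\}$, where $R_\theta$ is the rotation of the plane by the angle $\theta$. For a Borel probability measure $\sigma$ on $\mathbb R^2$ put $\widehat\sigma(\xi)=\int e^{-2\pi i\langle x,\xi\rangle}\,d\sigma(x)$. Theorem. There are an absolute constant $c>0$ and numbers $\delta(\Lambda,\varepsilon)>0$, defined for all lattices $\Lambda\subset\mathbb R^2$ and all $\varepsilon>0$, such that for every lattice $\Lambda$ $$\frac{\delta(\Lambda,\varepsilon)}{\operatorname{dens}\Lambda\cdot\varepsilon^2}\to c\qquad(\varepsilon\to0^+),$$ and such that the following holds for every lattice $\Lambda$ and every $\varepsilon>0$. If $\Theta\subseteq S^1$ carries a Borel probability measure $\sigma$ (i.e. the complement of $\Theta$ is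 $\sigma$-null) with $$\limsup_{|\xi|\to\infty}|\widehat\sigma(\xi)|<\delta(\Lambda,\varepsilon),$$ then $R_\Theta E$ contains the complement of a disk, where $E=\Lambda+B_\varepsilon(0)$. -/

import Mathlib

open MeasureTheory Filter Topology Bornology
open scoped Pointwise

/-! The plane is identified with `ℂ`; the circle `S¹` is `Metric.sphere (0 : ℂ) 1`, and the
rotation by the angle `θ ∈ S¹` is multiplication by `θ`. -/

/-- The density of a planar lattice: the number of its points per unit area, that is, the
reciprocal of the area of a fundamental domain. -/
noncomputable def latticeDensity (Λ : Submodule ℤ ℂ) : ℝ :=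
  (ZLattice.covolume Λ)⁻¹

/-- The fattened lattice `Λ + B_ε(0)`, where `B_ε(0)` is the open disk. -/
def fattenedLattice (Λ : Submodule ℤ ℂ) (ε : ℝ) : Set ℂ :=
  (Λ : Set ℂ) + Metric.ball (0 : ℂ) ε

/-- The union of the rotates of `E` by the angles in `Θ`. -/
def rotatedUnion (Θ E : Set ℂ) : Set ℂ :=
  {z | ∃ θ ∈ Θ, ∃ x ∈ E, z = θ * x}

/-- The set contains the complement of some disk. -/
def ContainsComplementOfDisk (S : Set ℂ) : Prop :=
  ∃ (a : ℂ) (r : ℝ), 0 < r ∧ (Metric.closedBall a r)ᶜ ⊆ S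

/-- The Fourier transform of a (finite) measure on the plane,
`σ̂(ξ) = ∫ exp(-2πi⟨x, ξ⟩) dσ(x)`, with the real scalar product of the plane. -/
noncomputable def planeFourier (σ : Measure ℂ) (ξ : ℂ) : ℂ :=
  ∫ x, Complex.exp (-(2 * Real.pi * inner ℝ x ξ : ℝ) * Complex.I) ∂σ

/-! If `z` is missed, then for every θ in Θ the coordinates of `conj θ * z` in a basis `v`, `w` of Λ
stay outside the boxes with half-sides η₁ = ε/(2‖v‖), η₂ = ε/(2‖w‖) around integer points. A product
of periodic tent functions supported on these boxes therefore vanishes on Θ. Its Fourier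
coefficients are nonnegative, the constant one is 1, and their sum is its value 1/(η₁η₂) at 0.
Integrating the series against σ turns each other character into σ̂ at a frequency of size at least
‖z‖/(‖v‖+‖w‖), so for large `z` smallness of σ̂ contradicts the constant term
(`one_le_of_hasSum_exp_eq_zero`). The threshold is η₁η₂ = ε²/(4‖v‖‖w‖), which for a reduced basis is
at least dens Λ · ε²/8. -/

/-! ### Fourier series of the periodic tent function -/

/-- Writing sin² through exponentials makes the series a second difference of the Bernoulli series ∑
e(ns)/n². The `xᵢ` are representatives in [0, 1], where that series is the polynomial B₂. -/
theorem hasSum_sinc_sq_mul_fourier {η : ℝ} (hη : η ≠ 0) {s x₀ x₁ x₂ : ℝ}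
    (h₀ : (x₀ : UnitAddCircle) = s) (h₁ : (x₁ : UnitAddCircle) = (s + η : ℝ))
    (h₂ : (x₂ : UnitAddCircle) = (s - η : ℝ))
    (hx₀ : x₀ ∈ Set.Icc (0 : ℝ) 1) (hx₁ : x₁ ∈ Set.Icc (0 : ℝ) 1)
    (hx₂ : x₂ ∈ Set.Icc (0 : ℝ) 1) :
    HasSum (fun n : ℤ => ((Real.sinc (Real.pi * n * η) ^ 2 : ℝ) : ℂ) *
        fourier n (s : UnitAddCircle))
      ((1 + 2 / η ^ 2 * (bernoulliFun 2 x₀ / 2 - bernoulliFun 2 x₁ / 4 - bernoulliFun 2 x₂ / 4) :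
        ℝ) : ℂ) := by
  have e₀ := hasSum_one_div_pow_mul_fourier_mul_bernoulliFun le_rfl hx₀
  have e₁ := hasSum_one_div_pow_mul_fourier_mul_bernoulliFun le_rfl hx₁
  have e₂ := hasSum_one_div_pow_mul_fourier_mul_bernoulliFun le_rfl hx₂
  rw [h₀] at e₀
  rw [h₁] at e₁
  rw [h₂] at e₂
  have hπ : (Real.pi : ℂ) ≠ 0 := by exact_mod_cast Real.pi_ne_zero
  have hη' : (η : ℂ) ≠ 0 := by exact_mod_cast hη
  -- In the Bernoulli series the term n = 0 is 1/0 = 0, so the constant term 1 is added by hand.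
  have key := (hasSum_ite_eq (0 : ℤ) (1 : ℂ)).add
    ((((e₀.div_const 2).sub (e₁.div_const 4)).sub (e₂.div_const 4)).mul_left
      (1 / ((Real.pi : ℂ) ^ 2 * (η : ℂ) ^ 2)))
  convert! key using 1
  · funext n
    by_cases hn : n = 0
    · subst hn
      simp
    · have hn' : (n : ℂ) ≠ 0 := by exact_mod_cast hn
      have harg : Real.pi * n * η ≠ 0 := by
        have : (n : ℝ) ≠ 0 := by exact_mod_cast hn
        have := Real.pi_ne_zero
        positivity
      have hadd : fourier n ((s + η : ℝ) : UnitAddCircle) =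
          fourier n (s : UnitAddCircle) * Complex.exp (2 * (Real.pi * n * η) * Complex.I) := by
        rw [fourier_coe_apply, fourier_coe_apply, ← Complex.exp_add]
        congr 1
        push_cast
        ring
      have hsub : fourier n ((s - η : ℝ) : UnitAddCircle) =
          fourier n (s : UnitAddCircle) * Complex.exp (-(2 * (Real.pi * n * η)) * Complex.I) := by
        rw [fourier_coe_apply, fourier_coe_apply, ← Complex.exp_add]
        congr 1
        push_cast
        ring
      have hcos : Complex.exp (2 * (Real.pi * n * η) * Complex.I) +
          Complex.exp (-(2 * (Real.pi * n * η)) * Complex.I) =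
          2 - 4 * Complex.sin (Real.pi * n * η) ^ 2 := by
        rw [← Complex.two_cos, Complex.cos_two_mul, Complex.cos_sq']
        ring
      have hexp : Complex.exp (-(2 * (Real.pi * n * η)) * Complex.I) =
          2 - 4 * Complex.sin (Real.pi * n * η) ^ 2 -
            Complex.exp (2 * (Real.pi * n * η) * Complex.I) := by
        rw [← hcos]; ring
      rw [hadd, hsub, hexp, Real.sinc_of_ne_zero harg, if_neg hn]
      push_cast
      field_simp
      ring
  · have : (2 * (Real.pi : ℂ) * Complex.I) ^ 2 = -(4 * (Real.pi : ℂ) ^ 2) := by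
      rw [mul_pow, mul_pow, Complex.I_sq]; ring
    rw [this]
    push_cast
    simp only [Nat.factorial]
    push_cast
    field_simp
    ring

theorem hasSum_sinc_sq {η : ℝ} (hη : 0 < η) (hη1 : η ≤ 1 / 2) :
    HasSum (fun n : ℤ => Real.sinc (Real.pi * n * η) ^ 2) (1 / η) := by
  have h := hasSum_sinc_sq_mul_fourier (s := 0) (x₀ := 0) (x₁ := η) (x₂ := 1 - η) hη.ne' rfl
    (by simp) (by simp [sub_eq_add_neg, AddCircle.coe_period])
    (by simp) ⟨by linarith, by linarith⟩ ⟨by linarith, by linarith⟩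
  simp only [bernoulliFun_two] at h
  rw [← Complex.hasSum_ofReal]
  convert! h using 1
  · simp
  · congr 1
    field_simp
    ring

/-- Away from the integers s ± η does not wrap around, and the second difference of the monic
quadratic B₂ is constant; it cancels the constant term. -/
theorem hasSum_sinc_sq_mul_fourier_eq_zero {η : ℝ} (hη : 0 < η) {s : ℝ}
    (hs : ∀ m : ℤ, η ≤ |s - m|) :
    HasSum (fun n : ℤ => ((Real.sinc (Real.pi * n * η) ^ 2 : ℝ) : ℂ) *
      fourier n (s : UnitAddCircle)) 0 := by
  have hfl := hs ⌊s⌋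
  have hfl1 := hs (⌊s⌋ + 1)
  push_cast at hfl1
  have hf0 := Int.fract_nonneg s
  have hf1 := (Int.fract_lt_one s).le
  have hfr : Int.fract s = s - ⌊s⌋ := rfl
  rw [← hfr, abs_of_nonneg hf0] at hfl
  have : s - (⌊s⌋ + 1) = -(1 - Int.fract s) := by rw [hfr]; ring
  rw [this, abs_neg, abs_of_nonneg (by linarith)] at hfl1
  have hcoe : ((Int.fract s : ℝ) : UnitAddCircle) = s := by
    rw [← sub_eq_zero, ← AddCircle.coe_sub, AddCircle.coe_eq_zero_iff]
    exact ⟨-⌊s⌋, by rw [hfr, zsmul_one]; push_cast; ring⟩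
  have h := hasSum_sinc_sq_mul_fourier (s := s) (x₀ := Int.fract s) (x₁ := Int.fract s + η)
    (x₂ := Int.fract s - η) hη.ne' hcoe
    (by rw [AddCircle.coe_add, hcoe, AddCircle.coe_add])
    (by rw [AddCircle.coe_sub, hcoe, AddCircle.coe_sub])
    ⟨hf0, hf1⟩ ⟨by linarith, by linarith⟩ ⟨by linarith, by linarith⟩
  simp only [bernoulliFun_two] at h
  convert! h using 1
  symm
  norm_cast
  field_simp
  ring

/-! ### Integrating a vanishing exponential sum -/

theorem norm_planeFourier_le_one (σ : Measure ℂ) [IsProbabilityMeasure σ] (ξ : ℂ) :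
    ‖planeFourier σ ξ‖ ≤ 1 := by
  have h : ∀ᵐ x ∂σ,
      ‖Complex.exp (-(2 * Real.pi * inner ℝ x ξ : ℝ) * Complex.I)‖ ≤ 1 := by
    refine ae_of_all _ fun x => ?_
    rw [← Complex.ofReal_neg, Complex.norm_exp_ofReal_mul_I]
  simpa [planeFourier] using norm_integral_le_of_norm_le_const h

/-- If an absolutely convergent exponential sum with nonnegative coefficients and constant term `1`
vanishes almost everywhere, then the Fourier transform is not small at all other frequencies. -/
theorem one_le_of_hasSum_exp_eq_zero {ι : Type*} [Countable ι] (σ : Measure ℂ)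
    [IsProbabilityMeasure σ] {c : ι → ℝ} (hc : ∀ i, 0 ≤ c i) {C : ℝ} (hC : HasSum c C)
    {ξ : ι → ℂ} {i₀ : ι} (hi₀ : c i₀ = 1) (hξ : ξ i₀ = 0) {δ : ℝ}
    (hδ : ∀ i, i ≠ i₀ → ‖planeFourier σ (ξ i)‖ ≤ δ)
    (h : ∀ᵐ x ∂σ, HasSum (fun i => (c i : ℂ) *
      Complex.exp (-(2 * Real.pi * inner ℝ x (ξ i) : ℝ) * Complex.I)) 0) :
    1 ≤ δ * (C - 1) := by
  classical
  have hnorm : ∀ i x, ‖(c i : ℂ) *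
      Complex.exp (-(2 * Real.pi * inner ℝ x (ξ i) : ℝ) * Complex.I)‖ = c i := by
    intro i x
    rw [norm_mul, ← Complex.ofReal_neg, Complex.norm_exp_ofReal_mul_I, mul_one,
      Complex.norm_real, Real.norm_of_nonneg (hc i)]
  have hint := hasSum_integral_of_summable_integral_norm (μ := σ)
    (F := fun i x => (c i : ℂ) *
      Complex.exp (-(2 * Real.pi * inner ℝ x (ξ i) : ℝ) * Complex.I))
    (fun i => Integrable.of_bound (C := c i)
      (Continuous.aestronglyMeasurable (by fun_prop)) (ae_of_all _ fun x => (hnorm i x).le))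
    (by simp_rw [hnorm]; simpa using hC.summable)
  rw [integral_congr_ae (g := fun _ => (0 : ℂ)) (by
    filter_upwards [h] with x hx using hx.tsum_eq), integral_zero] at hint
  simp only [integral_const_mul] at hint
  change HasSum (fun i => (c i : ℂ) * planeFourier σ (ξ i)) 0 at hint
  -- Without the constant term the integrated series sums to -1, while its absolute values are
  -- dominated by δ times coefficients of total C - 1.
  have h1 := hint.sub (hasSum_ite_eq i₀ (1 : ℂ))
  have h2 := (hC.sub (hasSum_ite_eq i₀ (1 : ℝ))).mul_left δ
  have h3 := h1.norm_le_of_bounded h2 (fun i => by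
    by_cases hi : i = i₀
    · subst hi
      simp [hi₀, hξ, planeFourier]
    · simp only [if_neg hi, sub_zero, norm_mul, Complex.norm_real,
        Real.norm_of_nonneg (hc i)]
      rw [mul_comm]
      exact mul_le_mul_of_nonneg_right (hδ i hi) (hc i))
  simpa using h3

/-! ### Products of two tent functions -/

theorem summable_norm_sinc_sq_mul_fourier {η : ℝ} (hη : 0 < η) (hη1 : η ≤ 1 / 2) (s : ℝ) :
    Summable (fun n : ℤ =>
      ‖((Real.sinc (Real.pi * n * η) ^ 2 : ℝ) : ℂ) * fourier n (s : UnitAddCircle)‖) := by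
  refine (hasSum_sinc_sq hη hη1).summable.congr fun n => ?_
  rw [norm_mul, Complex.norm_real, Real.norm_of_nonneg (sq_nonneg _), fourier_apply,
    Circle.norm_coe, mul_one]

theorem HasSum.mul_prod_of_nonneg {ι κ : Type*} {f : ι → ℝ} {g : κ → ℝ} {A B : ℝ}
    (hf : HasSum f A) (hg : HasSum g B) (hf0 : ∀ i, 0 ≤ f i) (hg0 : ∀ i, 0 ≤ g i) :
    HasSum (fun p : ι × κ => f p.1 * g p.2) (A * B) :=
  hf.mul hg (hf.summable.mul_of_nonneg hg.summable hf0 hg0)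

theorem hasSum_mul_prod_eq_zero {ι κ : Type*} {f : ι → ℂ} {g : κ → ℂ}
    (hf : Summable fun i => ‖f i‖) (hg : Summable fun i => ‖g i‖)
    (h : HasSum f 0 ∨ HasSum g 0) : HasSum (fun p : ι × κ => f p.1 * g p.2) 0 := by
  have hprod := hf.of_norm.hasSum.mul hg.of_norm.hasSum (summable_mul_of_summable_norm hf hg)
  have hzero : (∑' i, f i) * ∑' i, g i = 0 :=
    mul_eq_zero.2 (h.imp HasSum.tsum_eq HasSum.tsum_eq)
  rwa [hzero] at hprod

theorem hasSum_sinc_sq_mul_sinc_sq {η₁ η₂ : ℝ} (h₁ : 0 < η₁) (h₁' : η₁ ≤ 1 / 2)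
    (h₂ : 0 < η₂) (h₂' : η₂ ≤ 1 / 2) :
    HasSum (fun p : ℤ × ℤ =>
      Real.sinc (Real.pi * p.1 * η₁) ^ 2 * Real.sinc (Real.pi * p.2 * η₂) ^ 2)
      (1 / η₁ * (1 / η₂)) :=
  (hasSum_sinc_sq h₁ h₁').mul_prod_of_nonneg (hasSum_sinc_sq h₂ h₂')
    (fun _ => sq_nonneg _) (fun _ => sq_nonneg _)

theorem hasSum_sinc_sq_mul_sinc_sq_mul_fourier_eq_zero {η₁ η₂ : ℝ} (h₁ : 0 < η₁)
    (h₁' : η₁ ≤ 1 / 2) (h₂ : 0 < η₂) (h₂' : η₂ ≤ 1 / 2) {s t : ℝ}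
    (h : ∀ m n : ℤ, |s - m| < η₁ → η₂ ≤ |t - n|) :
    HasSum (fun p : ℤ × ℤ =>
      ((Real.sinc (Real.pi * p.1 * η₁) ^ 2 * Real.sinc (Real.pi * p.2 * η₂) ^ 2 : ℝ) : ℂ) *
        (fourier p.1 (s : UnitAddCircle) * fourier p.2 (t : UnitAddCircle))) 0 := by
  have hprod := hasSum_mul_prod_eq_zero (summable_norm_sinc_sq_mul_fourier h₁ h₁' s)
    (summable_norm_sinc_sq_mul_fourier h₂ h₂' t) (by
      by_cases hs : ∀ m : ℤ, η₁ ≤ |s - m|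
      · exact Or.inl (hasSum_sinc_sq_mul_fourier_eq_zero h₁ hs)
      · push Not at hs
        obtain ⟨m, hm⟩ := hs
        exact Or.inr (hasSum_sinc_sq_mul_fourier_eq_zero h₂ fun n => h m n hm))
  convert! hprod using 2 with p
  rw [Complex.ofReal_mul]
  ring

/-! ### Covolume and reduced bases -/

/-- The oriented area of the parallelogram spanned by two vectors of the plane. -/
def planeDet (v w : ℂ) : ℝ := v.re * w.im - v.im * w.re

theorem sq_planeDet_add_sq_inner (v w : ℂ) :
    planeDet v w ^ 2 + (inner ℝ v w) ^ 2 = ‖v‖ ^ 2 * ‖w‖ ^ 2 := by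
  simp only [planeDet, Complex.inner, Complex.sq_norm, Complex.normSq_apply, Complex.mul_re,
    Complex.conj_re, Complex.conj_im]
  ring

theorem abs_planeDet_le (v w : ℂ) : |planeDet v w| ≤ ‖v‖ * ‖w‖ := by
  refine abs_le_of_sq_le_sq ?_ (by positivity)
  nlinarith [sq_planeDet_add_sq_inner v w, sq_nonneg (inner ℝ v w)]

theorem exists_span_pair_eq (Λ : Submodule ℤ ℂ) [DiscreteTopology Λ] [IsZLattice ℝ Λ] :
    ∃ v w : ℂ, Submodule.span ℤ {v, w} = Λ := by
  have hfr : Module.finrank ℤ Λ = 2 := by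
    rw [ZLattice.rank ℝ Λ, Complex.finrank_real_complex]
  have : Module.Free ℤ Λ := ZLattice.module_free ℝ Λ
  have : Module.Finite ℤ Λ := ZLattice.module_finite ℝ Λ
  let b := (Module.finBasisOfFinrankEq ℤ Λ hfr)
  refine ⟨b 0, b 1, ?_⟩
  have h := congrArg (Submodule.map Λ.subtype) b.span_eq
  rw [Submodule.map_span, Submodule.map_top, Submodule.range_subtype] at h
  refine Eq.trans ?_ h
  congr 1
  ext x
  simp [Fin.exists_fin_two, eq_comm]

theorem top_le_span_of_span_pair {Λ : Submodule ℤ ℂ} [DiscreteTopology Λ] [IsZLattice ℝ Λ] {v w : ℂ}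
    (h : Submodule.span ℤ {v, w} = Λ) :
    ⊤ ≤ Submodule.span ℝ (Set.range ![v, w]) := by
  have := IsZLattice.span_top (K := ℝ) (L := Λ)
  rw [← this, ← h, Matrix.range_cons, Matrix.range_cons, Matrix.range_empty, Set.union_empty]
  exact Submodule.span_le.2 (Submodule.span_le_restrictScalars ℤ ℝ _)

theorem covolume_span_pair {Λ : Submodule ℤ ℂ} [DiscreteTopology Λ] [IsZLattice ℝ Λ] {v w : ℂ}
    (h : Submodule.span ℤ {v, w} = Λ) : ZLattice.covolume Λ = |planeDet v w| := by
  let b : Module.Basis (Fin 2) ℝ ℂ := basisOfTopLeSpanOfCardEqFinrank ![v, w]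
    (top_le_span_of_span_pair h) (by simp)
  have hb : ⇑b = ![v, w] := coe_basisOfTopLeSpanOfCardEqFinrank _ _ _
  have hspan : Submodule.span ℤ (Set.range b) = Λ := by
    rw [hb, ← h, Matrix.range_cons, Matrix.range_cons, Matrix.range_empty, Set.union_empty]
    rfl
  have hdom := ZSpan.isAddFundamentalDomain b volume
  rw [hspan] at hdom
  rw [ZLattice.covolume_eq_measure_fundamentalDomain Λ volume hdom,
    ZSpan.measureReal_fundamentalDomain b volume Complex.orthonormalBasisOneI.toBasis,
    measureReal_congr (ZSpan.fundamentalDomain_ae_parallelepiped _ volume), measureReal_def,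
    OrthonormalBasis.coe_toBasis, OrthonormalBasis.volume_parallelepiped, ENNReal.toReal_one,
    mul_one, hb, Module.Basis.det_apply, Matrix.det_fin_two]
  simp [Module.Basis.toMatrix_apply, planeDet, mul_comm]

/-- Every planar lattice has a reduced basis, whose vectors are nearly orthogonal. -/
theorem exists_reduced_span_pair (Λ : Submodule ℤ ℂ) [DiscreteTopology Λ] [IsZLattice ℝ Λ] :
    ∃ v w : ℂ, Submodule.span ℤ {v, w} = Λ ∧ ‖v‖ * ‖w‖ ≤ 2 * |planeDet v w| := by
  obtain ⟨v₀, w₀, h₀⟩ := exists_span_pair_eq Λ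
  -- A basis minimising `f` is reduced; discreteness leaves finitely many candidates below the given
  -- basis.
  let f : ℂ × ℂ → ℝ := fun p => ‖p.1‖ ^ 2 + ‖p.2‖ ^ 2
  let S : Set (ℂ × ℂ) := {p | Submodule.span ℤ {p.1, p.2} = Λ ∧ f p ≤ f (v₀, w₀)}
  have hS : S.Finite := by
    have hfin : ((Λ : Set ℂ) ∩ Metric.closedBall 0 (Real.sqrt (f (v₀, w₀)))).Finite := by
      have := Metric.finite_isBounded_inter_isClosed (s := (Λ : Set ℂ))
        (K := Metric.closedBall (0 : ℂ) (Real.sqrt (f (v₀, w₀))))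
        ⟨‹_›⟩ Metric.isBounded_closedBall
        (AddSubgroup.isClosed_of_discrete (H := Λ.toAddSubgroup))
      rwa [Set.inter_comm]
    refine (hfin.prod hfin).subset ?_
    rintro ⟨v, w⟩ ⟨h, hle⟩
    simp only [f] at hle
    refine ⟨⟨?_, ?_⟩, ⟨?_, ?_⟩⟩
    · rw [← h]; exact Submodule.subset_span (by simp)
    · rw [mem_closedBall_zero_iff]
      exact Real.le_sqrt_of_sq_le (by simp only [f]; nlinarith [sq_nonneg ‖w‖])
    · rw [← h]; exact Submodule.subset_span (by simp)
    · rw [mem_closedBall_zero_iff]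
      exact Real.le_sqrt_of_sq_le (by simp only [f]; nlinarith [sq_nonneg ‖v‖])
  obtain ⟨⟨v, w⟩, ⟨h, hle⟩, hmin⟩ := Set.exists_min_image S f hS ⟨(v₀, w₀), h₀, le_rfl⟩
  have hmin' : ∀ v' w' : ℂ, Submodule.span ℤ {v', w'} = Λ →
      ‖v‖ ^ 2 + ‖w‖ ^ 2 ≤ ‖v'‖ ^ 2 + ‖w'‖ ^ 2 := by
    intro v' w' h'
    by_cases hc : f (v', w') ≤ f (v₀, w₀)
    · exact hmin (v', w') ⟨h', hc⟩
    · exact hle.trans (not_le.1 hc).le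
  have hv : ∀ k : ℤ, Submodule.span ℤ {v, w + k • v} = Λ := by
    intro k
    rw [← h]
    refine le_antisymm (Submodule.span_le.2 ?_) (Submodule.span_le.2 ?_)
    · rintro x (rfl | rfl)
      · exact Submodule.subset_span (by simp)
      · exact Submodule.mem_span_pair.2 ⟨k, 1, by simp [add_comm]⟩
    · rintro x (rfl | rfl)
      · exact Submodule.subset_span (by simp)
      · exact Submodule.mem_span_pair.2 ⟨-k, 1, by simp⟩
  have hw : ∀ k : ℤ, Submodule.span ℤ {v + k • w, w} = Λ := by
    intro k
    rw [← h]
    refine le_antisymm (Submodule.span_le.2 ?_) (Submodule.span_le.2 ?_)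
    · rintro x (rfl | rfl)
      · exact Submodule.mem_span_pair.2 ⟨1, k, by simp⟩
      · exact Submodule.subset_span (by simp)
    · rintro x (rfl | rfl)
      · exact Submodule.mem_span_pair.2 ⟨1, -k, by simp⟩
      · exact Submodule.subset_span (by simp)
  -- Minimality against w ± v and v ± w bounds 2|⟨v, w⟩| by both ‖v‖² and ‖w‖². Lagrange's identity
  -- then gives det² ≥ (3/4)‖v‖²‖w‖², more than needed.
  have e1 := hmin' _ _ (hv 1)
  have e2 := hmin' _ _ (hv (-1))
  have e3 := hmin' _ _ (hw 1)
  have e4 := hmin' _ _ (hw (-1))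
  simp only [neg_smul, one_smul, ← sub_eq_add_neg, norm_add_sq_real, norm_sub_sq_real] at e1 e2 e3 e4
  rw [real_inner_comm] at e1 e2
  refine ⟨v, w, h, ?_⟩
  have hi1 : 2 * |inner ℝ v w| ≤ ‖v‖ ^ 2 := by
    rcases abs_cases (inner ℝ v w) with ⟨h, -⟩ | ⟨h, -⟩ <;> rw [h] <;> linarith
  have hi2 : 2 * |inner ℝ v w| ≤ ‖w‖ ^ 2 := by
    rcases abs_cases (inner ℝ v w) with ⟨h, -⟩ | ⟨h, -⟩ <;> rw [h] <;> linarith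
  have hi : 4 * inner ℝ v w ^ 2 ≤ ‖v‖ ^ 2 * ‖w‖ ^ 2 := by
    have := mul_le_mul hi1 hi2 (by positivity) (by positivity)
    rw [← sq_abs]
    linarith
  refine abs_le_of_sq_le_sq' ?_ (by positivity) |>.2
  have := sq_planeDet_add_sq_inner v w
  rw [mul_pow, mul_pow, sq_abs]
  nlinarith [mul_nonneg (sq_nonneg ‖v‖) (sq_nonneg ‖w‖)]

/-! ### Lattice coordinates and rotation frequencies -/

/-- The frequency of `θ ↦ planeDet (conj θ * z) w / D`. -/
theorem inner_eq_planeDet (θ z w : ℂ) (D : ℝ) :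
    inner ℝ θ (Complex.I * z * starRingEnd ℂ w / D) =
      planeDet (starRingEnd ℂ θ * z) w / D := by
  simp [Complex.inner, planeDet]
  ring

theorem eq_planeDet_smul_add {v w : ℂ} (hD : planeDet v w ≠ 0) (x : ℂ) :
    x = ((planeDet x w / planeDet v w : ℝ) : ℂ) * v +
      ((planeDet v x / planeDet v w : ℝ) : ℂ) * w := by
  have key : (planeDet v w : ℂ) * x = planeDet x w * v + planeDet v x * w := by
    apply Complex.ext <;> simp [planeDet] <;> ring
  have hD' : (planeDet v w : ℂ) ≠ 0 := by exact_mod_cast hD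
  push_cast
  field_simp
  linear_combination key

/-- Pairing jw - kv with `v` or `w` under the determinant kills one of its two terms. -/
theorem abs_mul_abs_planeDet_le (v w : ℂ) (j k : ℤ) :
    |(j : ℝ)| * |planeDet v w| ≤ ‖v‖ * ‖(j : ℂ) * w - k * v‖ ∧
      |(k : ℝ)| * |planeDet v w| ≤ ‖w‖ * ‖(j : ℂ) * w - k * v‖ := by
  constructor
  · convert abs_planeDet_le v ((j : ℂ) * w - k * v) using 1
    rw [← abs_mul]
    congr 1
    simp [planeDet]
    ring
  · convert abs_planeDet_le w ((j : ℂ) * w - k * v) using 1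
    rw [← abs_mul]
    congr 1
    simp [planeDet]
    ring

theorem mem_fattenedLattice_of_coord {Λ : Submodule ℤ ℂ} {v w : ℂ}
    (h : Submodule.span ℤ {v, w} = Λ) {ε s t : ℝ} (hv : v ≠ 0) (hw : w ≠ 0) {m n : ℤ}
    (hs : |s - m| < ε / (2 * ‖v‖)) (ht : |t - n| < ε / (2 * ‖w‖)) :
    (s : ℂ) * v + (t : ℂ) * w ∈ fattenedLattice Λ ε := by
  refine Set.mem_add.2 ⟨m * v + n * w, ?_, ((s - m : ℝ) : ℂ) * v + ((t - n : ℝ) : ℂ) * w, ?_, ?_⟩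
  · rw [← h]
    exact Submodule.mem_span_pair.2 ⟨m, n, by simp⟩
  · rw [mem_ball_zero_iff]
    have hv' := norm_pos_iff.2 hv
    have hw' := norm_pos_iff.2 hw
    rw [lt_div_iff₀ (by positivity)] at hs ht
    calc _ ≤ _ := norm_add_le _ _
      _ = |s - m| * ‖v‖ + |t - n| * ‖w‖ := by
        rw [norm_mul, norm_mul, Complex.norm_real, Complex.norm_real, Real.norm_eq_abs,
          Real.norm_eq_abs]
      _ < ε := by linarith
  · push_cast
    ring

/-- With `s`, `t` the coordinates of `conj θ * z` in the basis `v`, `w`, the frequency of the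
function `θ ↦ exp (2πi (j s + k t))`. -/
noncomputable def rotationFreq (v w z : ℂ) (p : ℤ × ℤ) : ℂ :=
  -((p.1 : ℂ) * (Complex.I * z * starRingEnd ℂ w / planeDet v w) -
    p.2 * (Complex.I * z * starRingEnd ℂ v / planeDet v w))

theorem norm_rotationFreq_mul {v w : ℂ} (hD : planeDet v w ≠ 0) (z : ℂ) (p : ℤ × ℤ) :
    ‖rotationFreq v w z p‖ * |planeDet v w| = ‖z‖ * ‖(p.1 : ℂ) * w - p.2 * v‖ := by
  have hD' : (planeDet v w : ℂ) ≠ 0 := by exact_mod_cast hD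
  have : rotationFreq v w z p * planeDet v w =
      -(Complex.I * z * starRingEnd ℂ ((p.1 : ℂ) * w - p.2 * v)) := by
    simp only [rotationFreq, map_sub, map_mul, map_intCast]
    field_simp
  rw [← Real.norm_eq_abs, ← Complex.norm_real, ← norm_mul, this, norm_neg, norm_mul, norm_mul,
    Complex.norm_I, one_mul, Complex.norm_conj]

/-- All nonzero frequencies escape to infinity uniformly as `z` does. -/
theorem norm_le_mul_norm_rotationFreq {v w : ℂ} (hD : planeDet v w ≠ 0) (z : ℂ) {p : ℤ × ℤ}
    (hp : p ≠ 0) : ‖z‖ ≤ (‖v‖ + ‖w‖) * ‖rotationFreq v w z p‖ := by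
  have hN := norm_rotationFreq_mul hD z p
  obtain ⟨ha, hb⟩ := abs_mul_abs_planeDet_le v w p.1 p.2
  have hD0 : 0 < |planeDet v w| := abs_pos.2 hD
  have hjk : 1 ≤ |(p.1 : ℝ)| + |(p.2 : ℝ)| := by
    have : p.1 ≠ 0 ∨ p.2 ≠ 0 := by
      by_contra hc
      push Not at hc
      exact hp (Prod.ext hc.1 hc.2)
    rcases this with h | h
    · have : (1 : ℝ) ≤ |(p.1 : ℝ)| := by exact_mod_cast Int.one_le_abs h
      linarith [abs_nonneg (p.2 : ℝ)]
    · have : (1 : ℝ) ≤ |(p.2 : ℝ)| := by exact_mod_cast Int.one_le_abs h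
      linarith [abs_nonneg (p.1 : ℝ)]
  have hDN : |planeDet v w| ≤ (‖v‖ + ‖w‖) * ‖(p.1 : ℂ) * w - p.2 * v‖ := by nlinarith
  refine le_of_mul_le_mul_right ?_ hD0
  calc ‖z‖ * |planeDet v w| ≤ ‖z‖ * ((‖v‖ + ‖w‖) * ‖(p.1 : ℂ) * w - p.2 * v‖) := by gcongr
    _ = (‖v‖ + ‖w‖) * (‖z‖ * ‖(p.1 : ℂ) * w - p.2 * v‖) := by ring
    _ = (‖v‖ + ‖w‖) * ‖rotationFreq v w z p‖ * |planeDet v w| := by rw [← hN]; ring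

theorem exp_inner_rotationFreq (v w z θ : ℂ) (p : ℤ × ℤ) :
    Complex.exp (-(2 * Real.pi * inner ℝ θ (rotationFreq v w z p) : ℝ) * Complex.I) =
      fourier p.1 ((planeDet (starRingEnd ℂ θ * z) w / planeDet v w : ℝ) : UnitAddCircle) *
      fourier p.2 ((planeDet v (starRingEnd ℂ θ * z) / planeDet v w : ℝ) : UnitAddCircle) := by
  have e : ∀ (n : ℤ) (y : ℂ), inner ℝ θ ((n : ℂ) * y) = n * inner ℝ θ y := fun n y => by
    simpa using real_inner_smul_right θ y (n : ℝ)
  have hanti : planeDet v (starRingEnd ℂ θ * z) = -planeDet (starRingEnd ℂ θ * z) v := by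
    simp only [planeDet]
    ring
  rw [rotationFreq, inner_neg_right, inner_sub_right, e, e, inner_eq_planeDet, inner_eq_planeDet,
    hanti, fourier_coe_apply, fourier_coe_apply, ← Complex.exp_add]
  congr 1
  push_cast
  ring

/-! ### Proof of the theorem -/

theorem containsComplementOfDisk_of_limsup_lt {Λ : Submodule ℤ ℂ} {v w : ℂ}
    (h : Submodule.span ℤ {v, w} = Λ) (hD : planeDet v w ≠ 0) {ε : ℝ} (hε : 0 < ε)
    (hεv : ε ≤ ‖v‖) (hεw : ε ≤ ‖w‖) {Θ : Set ℂ} (hΘ : Θ ⊆ Metric.sphere (0 : ℂ) 1)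
    (σ : Measure ℂ) [IsProbabilityMeasure σ] (hσ : σ Θᶜ = 0)
    (hlim : limsup (fun ξ : ℂ => ‖planeFourier σ ξ‖) (cobounded ℂ) <
      ε / (2 * ‖v‖) * (ε / (2 * ‖w‖))) :
    ContainsComplementOfDisk (rotatedUnion Θ (fattenedLattice Λ ε)) := by
  have hv' : 0 < ‖v‖ := hε.trans_le hεv
  have hw' : 0 < ‖w‖ := hε.trans_le hεw
  have hη₁0 : 0 < ε / (2 * ‖v‖) := by positivity
  have hη₂0 : 0 < ε / (2 * ‖w‖) := by positivity
  have hη₁1 : ε / (2 * ‖v‖) ≤ 1 / 2 := by rw [div_le_iff₀ (by positivity)]; linarith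
  have hη₂1 : ε / (2 * ‖w‖) ≤ 1 / 2 := by rw [div_le_iff₀ (by positivity)]; linarith
  have hcoord : ∀ s t : ℝ, (s : ℂ) * v + (t : ℂ) * w ∉ fattenedLattice Λ ε →
      ∀ m n : ℤ, |s - m| < ε / (2 * ‖v‖) → ε / (2 * ‖w‖) ≤ |t - n| := by
    intro s t hst m n hm
    by_contra hn
    exact hst (mem_fattenedLattice_of_coord h (norm_pos_iff.1 hv') (norm_pos_iff.1 hw') hm
      (not_le.1 hn))
  generalize ε / (2 * ‖v‖) = η₁ at *
  generalize ε / (2 * ‖w‖) = η₂ at *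
  have hev := eventually_lt_of_limsup_lt hlim
    (isBoundedUnder_of ⟨1, fun ξ => norm_planeFourier_le_one σ ξ⟩)
  obtain ⟨r, -, hr⟩ := (hasBasis_cobounded_norm (E := ℂ)).eventually_iff.1 hev
  refine ⟨0, max r 1 * (‖v‖ + ‖w‖), by positivity, fun z hz => ?_⟩
  rw [Set.mem_compl_iff, mem_closedBall_zero_iff, not_le] at hz
  by_contra hbad
  have hout : ∀ θ ∈ Θ, starRingEnd ℂ θ * z ∉ fattenedLattice Λ ε := by
    intro θ hθ hmem
    refine hbad ⟨θ, hθ, _, hmem, ?_⟩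
    have h1 : ‖θ‖ = 1 := by simpa using hΘ hθ
    rw [← mul_assoc, Complex.mul_conj, Complex.normSq_eq_norm_sq, h1]
    simp
  have hsmall : ∀ p : ℤ × ℤ, p ≠ 0 → ‖planeFourier σ (rotationFreq v w z p)‖ ≤ η₁ * η₂ := by
    intro p hp
    refine (hr ((le_max_left r 1).trans (le_of_mul_le_mul_right ?_ (add_pos hv' hw')))).le
    linarith [norm_le_mul_norm_rotationFreq hD z hp]
  have hvanish : ∀ᵐ θ ∂σ, HasSum (fun p : ℤ × ℤ =>
      ((Real.sinc (Real.pi * p.1 * η₁) ^ 2 * Real.sinc (Real.pi * p.2 * η₂) ^ 2 : ℝ) : ℂ) *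
      Complex.exp (-(2 * Real.pi * inner ℝ θ (rotationFreq v w z p) : ℝ) * Complex.I)) 0 := by
    have hΘae : ∀ᵐ θ ∂σ, θ ∈ Θ := hσ
    filter_upwards [hΘae] with θ hθ
    simp only [exp_inner_rotationFreq]
    refine hasSum_sinc_sq_mul_sinc_sq_mul_fourier_eq_zero hη₁0 hη₁1 hη₂0 hη₂1 (hcoord _ _ ?_)
    rw [← eq_planeDet_smul_add hD]
    exact hout θ hθ
  have hsum := one_le_of_hasSum_exp_eq_zero σ (i₀ := (0 : ℤ × ℤ)) (fun p => by positivity)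
    (hasSum_sinc_sq_mul_sinc_sq hη₁0 hη₁1 hη₂0 hη₂1) (by simp) (by simp [rotationFreq])
    hsmall hvanish
  -- The contradiction is 1 ≤ 1 - η₁η₂.
  have : η₁ * η₂ * (1 / η₁ * (1 / η₂) - 1) = 1 - η₁ * η₂ := by field_simp
  rw [this] at hsum
  nlinarith [mul_pos hη₁0 hη₂0]

theorem rotatedUnion_fattenedLattice_mono (Θ : Set ℂ) (Λ : Submodule ℤ ℂ) {ε₁ ε₂ : ℝ}
    (h : ε₁ ≤ ε₂) :
    rotatedUnion Θ (fattenedLattice Λ ε₁) ⊆ rotatedUnion Θ (fattenedLattice Λ ε₂) := by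
  rintro z ⟨θ, hθ, x, hx, rfl⟩
  exact ⟨θ, hθ, x, Set.add_subset_add_left (Metric.ball_subset_ball h) hx, rfl⟩

theorem exists_radius_containsComplementOfDisk (Λ : Submodule ℤ ℂ) : ∃ ε₀ : ℝ, 0 < ε₀ ∧
    (∀ _ : DiscreteTopology Λ, IsZLattice ℝ Λ → ∀ ε, 0 < ε → ε ≤ ε₀ →
      ∀ Θ ⊆ Metric.sphere (0 : ℂ) 1, ∀ (σ : Measure ℂ) [IsProbabilityMeasure σ], σ Θᶜ = 0 →
        limsup (fun ξ : ℂ => ‖planeFourier σ ξ‖) (cobounded ℂ) <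
          1 / 8 * (latticeDensity Λ * ε ^ 2) →
        ContainsComplementOfDisk (rotatedUnion Θ (fattenedLattice Λ ε))) := by
  by_cases hΛ : ∃ _ : DiscreteTopology Λ, IsZLattice ℝ Λ
  · obtain ⟨_, _⟩ := hΛ
    obtain ⟨v, w, h, hred⟩ := exists_reduced_span_pair Λ
    have hcov := covolume_span_pair h
    have hpos : 0 < |planeDet v w| := hcov ▸ ZLattice.covolume_pos Λ volume
    have hvw : 0 < ‖v‖ * ‖w‖ := hpos.trans_le (abs_planeDet_le v w)
    have hv : 0 < ‖v‖ := pos_of_mul_pos_left hvw (norm_nonneg _)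
    have hw : 0 < ‖w‖ := pos_of_mul_pos_right hvw (norm_nonneg _)
    -- For ε up to this bound both half-sides are at most 1/2.
    refine ⟨min ‖v‖ ‖w‖, lt_min hv hw, fun _ _ ε hε hle Θ hΘ σ _ hσ hlim => ?_⟩
    refine containsComplementOfDisk_of_limsup_lt h (abs_pos.1 hpos) hε
      (hle.trans (min_le_left _ _)) (hle.trans (min_le_right _ _)) hΘ σ hσ (hlim.trans_le ?_)
    rw [latticeDensity, hcov]
    calc 1 / 8 * (|planeDet v w|⁻¹ * ε ^ 2) = ε ^ 2 / (4 * (2 * |planeDet v w|)) := by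
          field_simp; norm_num
      _ ≤ ε ^ 2 / (4 * (‖v‖ * ‖w‖)) := by gcongr
      _ = ε / (2 * ‖v‖) * (ε / (2 * ‖w‖)) := by field_simp; norm_num
  · exact ⟨1, one_pos, fun h1 h2 => absurd ⟨h1, h2⟩ hΛ⟩

theorem theorem6p1 :
    ∃ c : ℝ, 0 < c ∧ ∃ δ : Submodule ℤ ℂ → ℝ → ℝ,
      ∀ (Λ : Submodule ℤ ℂ) [DiscreteTopology Λ] [IsZLattice ℝ Λ],
        (∀ ε : ℝ, 0 < ε → 0 < δ Λ ε) ∧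
        Tendsto (fun ε : ℝ => δ Λ ε / (latticeDensity Λ * ε ^ 2)) (𝓝[>] 0) (𝓝 c) ∧
        ∀ ε : ℝ, 0 < ε →
          ∀ (Θ : Set ℂ), Θ ⊆ Metric.sphere (0 : ℂ) 1 →
          ∀ (σ : Measure ℂ) [IsProbabilityMeasure σ], σ Θᶜ = 0 →
            limsup (fun ξ : ℂ => ‖planeFourier σ ξ‖) (cobounded ℂ) < δ Λ ε →
            ContainsComplementOfDisk (rotatedUnion Θ (fattenedLattice Λ ε)) := by
  choose ε₀ hε₀ hmain using exists_radius_containsComplementOfDisk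
  -- Beyond ε₀ the threshold is frozen, which suffices because the rotated set grows with ε; near 0
  -- the quotient is exactly 1/8.
  refine ⟨1 / 8, by norm_num, fun Λ ε => 1 / 8 * (latticeDensity Λ * min ε (ε₀ Λ) ^ 2), ?_⟩
  intro Λ _ _
  have hdens : 0 < latticeDensity Λ := inv_pos.2 (ZLattice.covolume_pos Λ volume)
  refine ⟨fun ε hε => ?_, ?_, fun ε hε Θ hΘ σ _ hσ hlim => ?_⟩
  · have := lt_min hε (hε₀ Λ)
    positivity
  · refine tendsto_const_nhds.congr' ?_
    filter_upwards [Ioo_mem_nhdsGT (hε₀ Λ)] with ε hε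
    rw [min_eq_left hε.2.le]
    have := hε.1
    field_simp
  · obtain ⟨a, r, hr, hsub⟩ := hmain Λ ‹_› ‹_› _ (lt_min hε (hε₀ Λ)) (min_le_right _ _)
      Θ hΘ σ hσ hlim
    exact ⟨a, r, hr, hsub.trans (rotatedUnion_fattenedLattice_mono Θ Λ (min_le_left _ _))⟩
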